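/- Let $\mathbf{B}(0,1)$ be the space of bounded real-valued functions on the open interval $(0,1)$, with the topology of the norm $\|f\|=\sup_{q\in(0,1)}|f(q)|$. For a positive integer $m$ and $q\in(0,1)$ put $[m:q]=\frac{1-q^m}{1-q}$. Call a multi-index $\mathbf{k}=(k_1,\ldots,k_d)$ of positive integers, $d\geqslant 1$, admissible if $k_1\geqslant 2$. For $\mathbf{k}$ admissible and $r$ a positive integer define the functions of $q\in(0,1)$ $$\zeta[\mathbf{k};r:q)=\sum_{m_1>\cdots>m_d>m_{d+1}>0}\frac{q^{m_1(k_1-1)+\cdots+m_d(k_d-1)}}{[m_1:q]^{k_1}\cdots[m_d:q]^{k_d}\,m_{d+1}^{r}},$$ $$\zeta[\mathbf{k}:q]_1=\sum_{m_1>\cdots>m_d>1}\frac{q^{m_1(k_1-1)+\cdots+m_d(k_d-1)}}{[m_1:q]^{k_1}\cdots[m_d:q]^{k_d}},$$ where the $m_i$ are integers. These series converge for every $q\in(0,1)$, and the functions belong to $\mathbf{B}(0,1)$. Let $\mathcal{QZZ}\subset\mathbf{B}(0,1)$ be the set of all functions $\zeta[\mathbf{k};r:q)$ with $\mathbf{k}$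 admissible and $r\geqslant 1$. Let $\mathcal{QZZ}^{(1)}$ be the set of accumulation points of $\mathcal{QZZ}$ in $\mathbf{B}(0,1)$, and $\mathcal{QZZ}^{(2)}$ the set of accumulation points of $\mathcal{QZZ}^{(1)}$ in $\mathbf{B}(0,1)$. Then $$\mathcal{QZZ}^{(1)}=\{\zeta[\mathbf{k}:q]_1\mid \mathbf{k}\text{ is admissible}\}\cup\{0\}\qquad\text{and}\qquad \mathcal{QZZ}^{(2)}=\{0\}.$$ -/

import Mathlib

open scoped ENNReal

/-- The space `B(0,1)` of bounded real-valued functions on the open interval `(0,1)`, with the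
sup norm `‖f‖ = ⨆ q, |f q|` and the topology it induces. -/
abbrev B01 : Type := lp (fun _ : Set.Ioo (0 : ℝ) 1 => ℝ) ∞

/-- The `q`-integer `[m:q] = (1 - q ^ m) / (1 - q)`. -/
noncomputable def qInt (m : ℕ) (q : ℝ) : ℝ := (1 - q ^ m) / (1 - q)

/-- `k = (k₁, …, k_d)` is admissible: `d ≥ 1`, all `kᵢ ≥ 1`, and `k₁ ≥ 2`. -/
def Admissible {d : ℕ} (k : Fin d → ℕ) : Prop :=
  (∀ i, 1 ≤ k i) ∧ ∃ h : 0 < d, 2 ≤ k ⟨0, h⟩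

/-- The tuples of integers `m₁ > ⋯ > m_d > n`. -/
def DecTuple (d n : ℕ) : Type := {m : Fin d → ℕ // StrictAnti m ∧ ∀ i, n < m i}

/-- The factor `q ^ (m (k - 1)) / [m:q] ^ k`, for `k ≥ 1`. -/
noncomputable def qFactor (k m : ℕ) (q : ℝ) : ℝ := q ^ (m * (k - 1)) / qInt m q ^ k

/-- The summand of `ζ[k:q]_n`. -/
noncomputable def tailTerm {d : ℕ} (k : Fin d → ℕ) (n : ℕ) (q : ℝ) (m : DecTuple d n) : ℝ :=
  ∏ i, qFactor (k i) (m.1 i) q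

/-- The tail `ζ[k:q]_n`, the sum over `m₁ > ⋯ > m_d > n`, as a function of `q ∈ (0,1)`. -/
noncomputable def qzetaTail {d : ℕ} (k : Fin d → ℕ) (n : ℕ) (q : Set.Ioo (0 : ℝ) 1) : ℝ :=
  ∑' m : DecTuple d n, tailTerm k n q m

/-- The summand of `ζ[k;r:q)`; the last entry `m_{d+1}` of the tuple carries the factor
`1 / m_{d+1} ^ r`. -/
noncomputable def mixedTerm {d : ℕ} (k : Fin d → ℕ) (r : ℕ) (q : ℝ) (m : DecTuple (d + 1) 0) : ℝ :=
  (∏ i : Fin d, qFactor (k i) (m.1 i.castSucc) q) * (1 / (m.1 (Fin.last d) : ℝ) ^ r)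

/-- `ζ[k;r:q)`, the sum over `m₁ > ⋯ > m_d > m_{d+1} > 0`, as a function of `q ∈ (0,1)`. -/
noncomputable def qzetaMixed {d : ℕ} (k : Fin d → ℕ) (r : ℕ) (q : Set.Ioo (0 : ℝ) 1) : ℝ :=
  ∑' m : DecTuple (d + 1) 0, mixedTerm k r q m

/-- The set of all `ζ[k;r:q)` with `k` admissible and `r ≥ 1`, inside `B(0,1)`. -/
def QZZ : Set B01 :=
  {f | ∃ (d : ℕ) (k : Fin d → ℕ) (r : ℕ),
    Admissible k ∧ 1 ≤ r ∧ (f : Set.Ioo (0 : ℝ) 1 → ℝ) = qzetaMixed k r}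

/-- The set of all tails `ζ[k:q]_1` with `k` admissible, inside `B(0,1)`. -/
def QZTails : Set B01 :=
  {f | ∃ (d : ℕ) (k : Fin d → ℕ),
    Admissible k ∧ (f : Set.Ioo (0 : ℝ) 1 → ℝ) = qzetaTail k 1}

/-! ### Estimates for a single factor -/

section QFactor

variable {q : ℝ}

/-! Let w be the weight k₁ + ⋯ + k_d and a(m) = q^m / [m:q]. Since a(m) - a(m+1) = q^m / ([m:q]
[m+1:q]), summing over the smallest entry telescopes, and induction on the depth gives ζ[k:q]_n ≤ 2
q^(w-2) a(n+1) (`summable_tail_and_le`). As 1/m ≤ 1/[m:q], one more round gives ζ[k;r:q) ≤ 2 q^w.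
Hence at a fixed q only finitely many k give values above a given ε > 0 (`finite_admissible_lt`).

For fixed k, the terms with m_{d+1} = 1 contribute exactly ζ[k:q]_1 for every r; the rest is
positive and O(2^(-r)) uniformly in q. So ζ[k;r:q) tends to ζ[k:q]_1 in norm without reaching it. If
f is an accumulation point with f(q) ≠ 0, only finitely many k occur near f, so f is an accumulation
point of the sequence of a single k, hence its limit. The same finiteness excludes nonzero
accumulation points of the tails, while 0 is one because ζ[l+2:q]_1 ≤ 2^(1-l). -/

theorem qInt_eq_geom_sum (hq : q < 1) (m : ℕ) : qInt m q = ∑ i ∈ Finset.range m, q ^ i := by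
  rw [qInt, geom_sum_eq hq.ne, ← neg_div_neg_eq, neg_sub, neg_sub]

theorem qInt_succ (hq : q < 1) (m : ℕ) : qInt (m + 1) q = 1 + q * qInt m q := by
  have : (1 : ℝ) - q ≠ 0 := by linarith
  unfold qInt
  field_simp
  ring

theorem one_le_qInt (hq0 : 0 < q) (hq : q < 1) {m : ℕ} (hm : 0 < m) : 1 ≤ qInt m q := by
  obtain ⟨m, rfl⟩ := Nat.exists_eq_succ_of_ne_zero hm.ne'
  rw [Nat.succ_eq_add_one, qInt_succ hq, qInt_eq_geom_sum hq]
  have : 0 ≤ q * ∑ i ∈ Finset.range m, q ^ i := by positivity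
  linarith

theorem qInt_le_natCast (hq0 : 0 < q) (hq : q < 1) (m : ℕ) : qInt m q ≤ m := by
  rw [qInt_eq_geom_sum hq]
  calc ∑ i ∈ Finset.range m, q ^ i ≤ ∑ i ∈ Finset.range m, (1 : ℝ) :=
        Finset.sum_le_sum fun i _ => pow_le_one₀ hq0.le hq.le
    _ = m := by simp

theorem qFactor_pos (hq0 : 0 < q) (hq : q < 1) (k : ℕ) {m : ℕ} (hm : 0 < m) :
    0 < qFactor k m q := by
  have := one_le_qInt hq0 hq hm
  unfold qFactor
  positivity

theorem qFactor_le (hq0 : 0 < q) (hq : q < 1) {k m : ℕ} (hk : 1 ≤ k) (hm : 0 < m) :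
    qFactor k m q ≤ q ^ (k - 1) / qInt m q := by
  have h1 := one_le_qInt hq0 hq hm
  unfold qFactor
  refine div_le_div₀ (by positivity) ?_ (by positivity) ?_
  · exact pow_le_pow_of_le_one hq0.le hq.le (Nat.le_mul_of_pos_left _ hm)
  · exact le_self_pow₀ h1 (by omega)

/-- The telescoping form of the majorant of the leading factor. -/
theorem pow_div_qInt_sub (hq0 : 0 < q) (hq : q < 1) {m : ℕ} (hm : 0 < m) :
    q ^ m / qInt m q - q ^ (m + 1) / qInt (m + 1) q = q ^ m / (qInt m q * qInt (m + 1) q) := by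
  have h1 := one_le_qInt hq0 hq hm
  have h2 := one_le_qInt hq0 hq (Nat.succ_pos m)
  have h3 := qInt_succ hq m
  have : qInt m q ≠ 0 := by positivity
  have : qInt (m + 1) q ≠ 0 := by positivity
  field_simp
  rw [h3]
  ring

theorem qInt_succ_le_two_mul (hq0 : 0 < q) (hq : q < 1) {m : ℕ} (hm : 0 < m) :
    qInt (m + 1) q ≤ 2 * qInt m q := by
  have h1 := one_le_qInt hq0 hq hm
  rw [qInt_succ hq]
  nlinarith

/-- Base of the telescoping: m(k-1) ≥ (k-2) + m because m ≥ 1, and [m:q] [m+1:q] ≤ 2 [m:q]^2 is the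
source of the constant 2. -/
theorem qFactor_le_sub (hq0 : 0 < q) (hq : q < 1) {k m : ℕ} (hk : 2 ≤ k) (hm : 0 < m) :
    qFactor k m q ≤
      2 * q ^ (k - 2) * (q ^ m / qInt m q - q ^ (m + 1) / qInt (m + 1) q) := by
  have h1 := one_le_qInt hq0 hq hm
  have h2 := one_le_qInt hq0 hq (Nat.succ_pos m)
  have h3 := qInt_succ_le_two_mul hq0 hq hm
  rw [pow_div_qInt_sub hq0 hq hm]
  obtain ⟨l, rfl⟩ := Nat.exists_eq_add_of_le hk
  have e1 : 2 + l - 1 = l + 1 := by omega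
  have e2 : 2 + l - 2 = l := by omega
  rw [qFactor, e1, e2, div_le_iff₀ (by positivity)]
  have hA : q ^ (m * (l + 1)) ≤ q ^ l * q ^ m := by
    rw [← pow_add]
    exact pow_le_pow_of_le_one hq0.le hq.le (by nlinarith)
  have hB : qInt m q * qInt (m + 1) q ≤ 2 * qInt m q ^ (2 + l) := by
    have : qInt m q ^ 2 ≤ qInt m q ^ (2 + l) := pow_le_pow_right₀ h1 (by omega)
    nlinarith
  have hpos : 0 < qInt m q * qInt (m + 1) q := by positivity
  calc q ^ (m * (l + 1)) ≤ q ^ l * q ^ m * 1 := by simpa using hA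
    _ ≤ q ^ l * q ^ m * (2 * qInt m q ^ (2 + l) / (qInt m q * qInt (m + 1) q)) := by
        gcongr
        rwa [one_le_div hpos]
    _ = _ := by ring

/-- From `m = 2` on, raising the exponent costs at least a factor `2`, uniformly in `q`. -/
theorem qFactor_add_le (hq0 : 0 < q) (hq : q < 1) (l : ℕ) {m : ℕ} (hm : 1 < m) :
    qFactor (l + 2) m q ≤ (1 / 2) ^ l * qFactor 2 m q := by
  have h1 := one_le_qInt hq0 hq (by omega : 0 < m)
  have h0 : 0 < qInt m q := by positivity
  have hx : q ^ m / qInt m q ≤ 1 / 2 := by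
    obtain ⟨n, rfl⟩ := Nat.exists_eq_add_of_lt hm
    have e : 1 + n + 1 = n + 1 + 1 := by ring
    rw [e] at h0 h1 ⊢
    have h2 := one_le_qInt hq0 hq (Nat.succ_pos n)
    -- It suffices that 2 q^2 ≤ 1 + q ≤ [m:q].
    have h3 : q ^ (n + 1 + 1) ≤ q ^ 2 := pow_le_pow_of_le_one hq0.le hq.le (by omega)
    rw [div_le_iff₀ h0, qInt_succ hq]
    nlinarith
  have e : qFactor (l + 2) m q = (q ^ m / qInt m q) ^ l * qFactor 2 m q := by
    have e1 : l + 2 - 1 = l + 1 := by omega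
    rw [qFactor, qFactor, e1, div_pow]
    field_simp
    ring
  rw [e]
  have := (qFactor_pos hq0 hq 2 (by omega : 0 < m)).le
  gcongr

end QFactor

/-! ### Splitting a decreasing tuple at its smallest entry -/

section Tuples

theorem snoc_mem_decTuple {d n a : ℕ} (ha : n < a) (m : DecTuple d a) :
    StrictAnti (Fin.snoc m.1 a : Fin (d + 1) → ℕ) ∧
      ∀ i, n < (Fin.snoc m.1 a : Fin (d + 1) → ℕ) i := by
  constructor
  · intro i j hij
    induction i using Fin.lastCases with
    | last => exact absurd hij (not_lt.2 (Fin.le_last j))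
    | cast i =>
      induction j using Fin.lastCases with
      | last => simpa using m.2.2 i
      | cast j => simpa using m.2.1 (by simpa using hij)
  · intro i
    induction i using Fin.lastCases with
    | last => simpa using ha
    | cast i => simpa using ha.trans (m.2.2 i)

/-- A decreasing tuple is its smallest entry together with the tuple of the others. -/
noncomputable def decTupleEquiv (d n : ℕ) :
    (Σ j : ℕ, DecTuple d (n + 1 + j)) ≃ DecTuple (d + 1) n :=
  Equiv.ofBijective
    (fun p => ⟨Fin.snoc p.2.1 (n + 1 + p.1), snoc_mem_decTuple (by omega) p.2⟩) <| by
    constructor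
    · rintro ⟨i, x⟩ ⟨j, y⟩ h
      have h' : (Fin.snoc x.1 (n + 1 + i) : Fin (d + 1) → ℕ) = Fin.snoc y.1 (n + 1 + j) :=
        congrArg Subtype.val h
      have hl := congrFun h' (Fin.last d)
      simp only [Fin.snoc_last] at hl
      obtain rfl : i = j := by omega
      congr 1
      refine Subtype.ext (funext fun a => ?_)
      simpa using congrFun h' a.castSucc
    · intro m
      have hm := m.2.2 (Fin.last d)
      have hj : n + 1 + (m.1 (Fin.last d) - (n + 1)) = m.1 (Fin.last d) := by omega
      refine ⟨⟨m.1 (Fin.last d) - (n + 1), fun i => m.1 i.castSucc,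
        fun i j hij => m.2.1 (by simpa using hij), fun i => ?_⟩, Subtype.ext (funext fun i => ?_)⟩
      · rw [hj]
        exact m.2.1 (Fin.castSucc_lt_last i)
      · induction i using Fin.lastCases with
        | last => simpa using hj
        | cast i => simp

instance (n : ℕ) : Unique (DecTuple 0 n) where
  default := ⟨Fin.elim0, fun i => i.elim0, fun i => i.elim0⟩
  uniq _ := Subtype.ext (funext fun i => i.elim0)

instance (d n : ℕ) : Nonempty (DecTuple d n) := by
  refine ⟨⟨fun i => n + d - i, fun i j hij => ?_, fun i => ?_⟩⟩
  · have := i.2; have := j.2; have : (i : ℕ) < j := hij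
    show n + d - (j : ℕ) < n + d - i
    omega
  · have := i.2
    show n < n + d - (i : ℕ)
    omega

end Tuples

/-! ### Convergence and the telescoping bound for tails -/

section Series

variable {d : ℕ} (k : Fin d → ℕ) (q : Set.Ioo (0 : ℝ) 1)

theorem tailTerm_pos (n : ℕ) (m : DecTuple d n) : 0 < tailTerm k n q m :=
  Finset.prod_pos fun i _ => qFactor_pos q.2.1 q.2.2 _ (Nat.zero_lt_of_lt (m.2.2 i))

theorem qzetaTail_nonneg (n : ℕ) : 0 ≤ qzetaTail k n q :=
  tsum_nonneg fun m => (tailTerm_pos k q n m).le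

variable {k q}

theorem qzetaTail_pos {n : ℕ} (h : Summable (tailTerm k n q)) : 0 < qzetaTail k n q :=
  h.tsum_pos (fun m => (tailTerm_pos k q n m).le) (Classical.arbitrary _)
    (tailTerm_pos k q n _)

/-- Summation over the smallest entry last. -/
theorem hasSum_weighted {g : ℕ → ℝ} {n : ℕ} (hg : ∀ m, n < m → 0 ≤ g m)
    (h1 : ∀ j, Summable (tailTerm k (n + 1 + j) q))
    (h2 : Summable fun j => g (n + 1 + j) * qzetaTail k (n + 1 + j) q) :
    HasSum (fun m : DecTuple (d + 1) n =>
        (∏ i : Fin d, qFactor (k i) (m.1 i.castSucc) q) * g (m.1 (Fin.last d)))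
      (∑' j, g (n + 1 + j) * qzetaTail k (n + 1 + j) q) := by
  have hs : ∀ j, HasSum (fun m => tailTerm k (n + 1 + j) q m * g (n + 1 + j))
      (g (n + 1 + j) * qzetaTail k (n + 1 + j) q) := fun j => by
    rw [mul_comm]
    exact (h1 j).hasSum.mul_right _
  have hnn : ∀ p : Σ j : ℕ, DecTuple d (n + 1 + j),
      0 ≤ tailTerm k (n + 1 + p.1) q p.2 * g (n + 1 + p.1) := fun p =>
    mul_nonneg (tailTerm_pos k q (n + 1 + p.1) p.2).le (hg _ (by omega))
  have hsum : Summable fun p : Σ j : ℕ, DecTuple d (n + 1 + j) =>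
      tailTerm k (n + 1 + p.1) q p.2 * g (n + 1 + p.1) :=
    (summable_sigma_of_nonneg hnn).2
      ⟨fun j => (hs j).summable, h2.congr fun j => (hs j).tsum_eq.symm⟩
  have ht := hsum.hasSum.sigma hs
  rw [ht.tsum_eq, ← (decTupleEquiv d n).hasSum_iff]
  refine hsum.hasSum.congr_fun fun p => ?_
  show (∏ i : Fin d, qFactor (k i)
      ((Fin.snoc p.2.1 (n + 1 + p.1) : Fin (d + 1) → ℕ) i.castSucc) q) *
        g ((Fin.snoc p.2.1 (n + 1 + p.1) : Fin (d + 1) → ℕ) (Fin.last d)) =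
      tailTerm k (n + 1 + p.1) q p.2 * g (n + 1 + p.1)
  simp only [Fin.snoc_castSucc, Fin.snoc_last, tailTerm]

/-- The bound reproduces itself under induction on the depth: multiplying q^(m+1) / [m+1:q] by 1 /
[m:q] gives q (a m - a (m+1)), which telescopes. -/
theorem summable_tail_and_le {k : Fin (d + 1) → ℕ} (hk : ∀ i, 1 ≤ k i) (h0 : 2 ≤ k 0) (n : ℕ) :
    Summable (tailTerm k n q) ∧ qzetaTail k n q ≤
      2 * q ^ (∑ i, k i - 2) * ((q : ℝ) ^ (n + 1) / qInt (n + 1) q) := by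
  have hq0 := q.2.1
  have hq1 := q.2.2
  set a : ℕ → ℝ := fun m => (q : ℝ) ^ m / qInt m q with ha
  have ha0 : ∀ m, 0 < m → 0 ≤ a m := fun m hm => by
    have := one_le_qInt hq0 hq1 hm
    positivity
  -- One summation over the smallest entry, shared by the base case and the inductive step.
  have key : ∀ {d : ℕ} {k : Fin (d + 1) → ℕ} (n : ℕ) (c : ℝ), 0 ≤ c →
      (∀ j, Summable (tailTerm (fun i : Fin d => k i.castSucc) (n + 1 + j) q)) →
      (∀ j, qFactor (k (Fin.last d)) (n + 1 + j) q *
        qzetaTail (fun i : Fin d => k i.castSucc) (n + 1 + j) q ≤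
          c * (a (n + 1 + j) - a (n + 1 + j + 1))) →
      Summable (tailTerm k n q) ∧ qzetaTail k n q ≤ c * a (n + 1) := by
    intro d k n c hc h1 h2
    have hnn : ∀ j, 0 ≤ qFactor (k (Fin.last d)) (n + 1 + j) q *
        qzetaTail (fun i : Fin d => k i.castSucc) (n + 1 + j) q := fun j =>
      mul_nonneg (qFactor_pos hq0 hq1 _ (by omega)).le (qzetaTail_nonneg _ _ _)
    have hle : ∀ N, ∑ j ∈ Finset.range N, qFactor (k (Fin.last d)) (n + 1 + j) q *
        qzetaTail (fun i : Fin d => k i.castSucc) (n + 1 + j) q ≤ c * a (n + 1) := fun N =>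
      calc _ ≤ ∑ j ∈ Finset.range N, c * (a (n + 1 + j) - a (n + 1 + (j + 1))) :=
            Finset.sum_le_sum fun j _ => h2 j
        _ = c * (a (n + 1) - a (n + 1 + N)) := by
            rw [← Finset.mul_sum, Finset.sum_range_sub' (fun j => a (n + 1 + j))]
        _ ≤ c * a (n + 1) := by
            have := ha0 (n + 1 + N) (by omega)
            gcongr
            linarith
    have := hasSum_weighted (g := fun m => qFactor (k (Fin.last d)) m q) (n := n)
      (fun m hm => (qFactor_pos hq0 hq1 _ (by omega)).le) h1 (summable_of_sum_range_le hnn hle)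
    have e : tailTerm k n q = fun m : DecTuple (d + 1) n =>
        (∏ i : Fin d, qFactor (k i.castSucc) (m.1 i.castSucc) q) *
          qFactor (k (Fin.last d)) (m.1 (Fin.last d)) q := by
      funext m
      rw [tailTerm, Fin.prod_univ_castSucc]
    rw [qzetaTail, e]
    exact ⟨this.summable, this.tsum_eq ▸ Real.tsum_le_of_sum_range_le hnn hle⟩
  induction d generalizing n with
  | zero =>
    refine key n _ (by positivity) (fun j => (hasSum_unique _).summable) fun j => ?_
    have e : qzetaTail (fun i : Fin 0 => k i.castSucc) (n + 1 + j) q = 1 := by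
      rw [qzetaTail, tsum_fintype]
      simp [tailTerm]
    have := qFactor_le_sub hq0 hq1 h0 (by omega : 0 < n + 1 + j)
    simpa [e] using this
  | succ d ih =>
    have hI := fun n => ih (k := fun i => k i.castSucc) (fun i => hk _) h0 n
    refine key n _ (by positivity) (fun j => (hI _).1) fun j => ?_
    set m := n + 1 + j with hm
    have hm0 : 0 < m := by omega
    have h1 := one_le_qInt hq0 hq1 hm0
    have h2 := one_le_qInt hq0 hq1 (Nat.succ_pos m)
    have hl := hk (Fin.last _)
    have hw : 2 ≤ ∑ i : Fin (d + 1), k i.castSucc :=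
      h0.trans (Finset.single_le_sum (f := fun i : Fin (d + 1) => k i.castSucc)
        (fun _ _ => Nat.zero_le _) (Finset.mem_univ 0))
    -- The final `+ 1` is the spare q in q^(m+1) = q · q^m.
    have e : ∑ i, k i - 2 = (k (Fin.last _) - 1) + (∑ i : Fin (d + 1), k i.castSucc - 2) + 1 := by
      rw [Fin.sum_univ_castSucc]
      omega
    calc qFactor (k (Fin.last _)) m q * qzetaTail (fun i => k i.castSucc) m q
        ≤ (q ^ (k (Fin.last _) - 1) / qInt m q) *
          (2 * q ^ (∑ i : Fin (d + 1), k i.castSucc - 2) *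
            ((q : ℝ) ^ (m + 1) / qInt (m + 1) q)) :=
          mul_le_mul (qFactor_le hq0 hq1 hl hm0) (hI m).2 (qzetaTail_nonneg _ _ _)
            (by positivity)
      _ = _ := by
          simp only [ha]
          rw [pow_div_qInt_sub hq0 hq1 hm0, e]
          field_simp
          ring

end Series

/-! ### Mixed sums: bound by the weight and convergence in r -/

section Mixed

variable {d : ℕ} {k : Fin d → ℕ}

theorem Admissible.two_le_sum (hk : Admissible k) : 2 ≤ ∑ i, k i := by
  obtain ⟨-, h, h2⟩ := hk
  exact h2.trans (Finset.single_le_sum (fun _ _ => Nat.zero_le _) (Finset.mem_univ _))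

theorem Admissible.summable_tail_and_le (hk : Admissible k) (n : ℕ) (q : Set.Ioo (0 : ℝ) 1) :
    Summable (tailTerm k n q) ∧ qzetaTail k n q ≤
      2 * q ^ (∑ i, k i - 2) * ((q : ℝ) ^ (n + 1) / qInt (n + 1) q) := by
  obtain ⟨hk1, h, h2⟩ := hk
  obtain ⟨d, rfl⟩ := Nat.exists_eq_succ_of_ne_zero h.ne'
  exact _root_.summable_tail_and_le hk1 h2 n

theorem Admissible.qzetaTail_le (hk : Admissible k) (q : Set.Ioo (0 : ℝ) 1) :
    qzetaTail k 1 q ≤ 2 * q ^ (∑ i, k i) := by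
  have h := (hk.summable_tail_and_le 1 q).2
  have hq := q.2.1
  have h1 := one_le_qInt q.2.1 q.2.2 (Nat.succ_pos 1)
  calc qzetaTail k 1 q
      ≤ 2 * q ^ (∑ i, k i - 2) * ((q : ℝ) ^ (1 + 1) / qInt (1 + 1) q) := h
    _ ≤ 2 * q ^ (∑ i, k i - 2) * (q : ℝ) ^ (1 + 1) := by
        gcongr
        exact div_le_self (by positivity) h1
    _ = 2 * q ^ (∑ i, k i) := by
        rw [mul_assoc, ← pow_add, Nat.sub_add_cancel hk.two_le_sum]

/-- The part of `ζ[k;r:q)` with smallest entry `0 + 1 + j`. -/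
noncomputable def mixedSlice (k : Fin d → ℕ) (r : ℕ) (q : Set.Ioo (0 : ℝ) 1) (j : ℕ) : ℝ :=
  1 / ((0 + 1 + j : ℕ) : ℝ) ^ r * qzetaTail k (0 + 1 + j) q

theorem mixedSlice_nonneg (r : ℕ) (q : Set.Ioo (0 : ℝ) 1) (j : ℕ) : 0 ≤ mixedSlice k r q j :=
  mul_nonneg (by positivity) (qzetaTail_nonneg _ _ _)

theorem mixedSlice_le_one {r : ℕ} (hr : 1 ≤ r) (q : Set.Ioo (0 : ℝ) 1) (j : ℕ) :
    mixedSlice k r q j ≤ mixedSlice k 1 q j := by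
  have h1 : (1 : ℝ) ≤ ((0 + 1 + j : ℕ) : ℝ) := by exact_mod_cast (by omega : 1 ≤ 0 + 1 + j)
  refine mul_le_mul_of_nonneg_right ?_ (qzetaTail_nonneg _ _ _)
  exact one_div_le_one_div_of_le (by positivity) (pow_le_pow_right₀ h1 hr)

theorem mixedSlice_succ_le (r : ℕ) (q : Set.Ioo (0 : ℝ) 1) (j : ℕ) :
    mixedSlice k (r + 1) q (j + 1) ≤ (1 / 2) ^ r * mixedSlice k 1 q (j + 1) := by
  have h2 : (2 : ℝ) ≤ ((0 + 1 + (j + 1) : ℕ) : ℝ) := by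
    exact_mod_cast (by omega : 2 ≤ 0 + 1 + (j + 1))
  rw [mixedSlice, mixedSlice, ← mul_assoc]
  refine mul_le_mul_of_nonneg_right ?_ (qzetaTail_nonneg _ _ _)
  rw [← one_div_pow, ← one_div_pow, pow_succ, pow_one]
  gcongr

/-- By 1/m ≤ 1/[m:q] the last entry behaves like a q-factor of exponent 1, so the sum telescopes
down to a 0 = q. -/
theorem Admissible.sum_mixedSlice_le (hk : Admissible k) (q : Set.Ioo (0 : ℝ) 1) (N : ℕ) :
    ∑ j ∈ Finset.range N, mixedSlice k 1 q j ≤ 2 * q ^ (∑ i, k i) := by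
  have hq0 := q.2.1
  have hq1 := q.2.2
  set a : ℕ → ℝ := fun j => (q : ℝ) ^ (j + 1) / qInt (j + 1) q with ha
  have hw : ∑ i, k i = (∑ i, k i - 2) + 2 := (Nat.sub_add_cancel hk.two_le_sum).symm
  have hstep : ∀ j, mixedSlice k 1 q j ≤ 2 * q ^ (∑ i, k i - 2) * q * (a j - a (j + 1)) := by
    intro j
    have hj : 0 + 1 + j = j + 1 := by ring
    have h1 := one_le_qInt hq0 hq1 (Nat.succ_pos j)
    have h2 := one_le_qInt hq0 hq1 (Nat.succ_pos (j + 1))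
    simp only [Nat.succ_eq_add_one] at h1 h2
    have h3 := qInt_le_natCast hq0 hq1 (j + 1)
    rw [mixedSlice, hj, pow_one]
    simp only [ha]
    rw [pow_div_qInt_sub hq0 hq1 (Nat.succ_pos j), Nat.succ_eq_add_one]
    calc 1 / ((j + 1 : ℕ) : ℝ) * qzetaTail k (j + 1) q
        ≤ 1 / qInt (j + 1) q * (2 * q ^ (∑ i, k i - 2) *
            ((q : ℝ) ^ (j + 1 + 1) / qInt (j + 1 + 1) q)) :=
          mul_le_mul (one_div_le_one_div_of_le (by positivity) h3)
            (hk.summable_tail_and_le _ q).2 (qzetaTail_nonneg _ _ _) (by positivity)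
      _ = _ := by
          field_simp
          ring
  calc _ ≤ ∑ j ∈ Finset.range N, 2 * q ^ (∑ i, k i - 2) * q * (a j - a (j + 1)) :=
        Finset.sum_le_sum fun j _ => hstep j
    _ = 2 * q ^ (∑ i, k i - 2) * q * (a 0 - a N) := by
        rw [← Finset.mul_sum, Finset.sum_range_sub']
    _ ≤ 2 * q ^ (∑ i, k i - 2) * q * q := by
        have hN := one_le_qInt hq0 hq1 (Nat.succ_pos N)
        simp only [Nat.succ_eq_add_one] at hN
        have : 0 ≤ a N := by simp only [ha]; positivity
        have h0 : a 0 = q := by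
          simp [ha, qInt, div_self (by linarith : (1 : ℝ) - q ≠ 0)]
        gcongr
        linarith
    _ = 2 * q ^ (∑ i, k i) := by
        conv_rhs => rw [hw]
        ring

theorem Admissible.summable_mixedSlice (hk : Admissible k) {r : ℕ} (hr : 1 ≤ r)
    (q : Set.Ioo (0 : ℝ) 1) : Summable (mixedSlice k r q) :=
  summable_of_sum_range_le (mixedSlice_nonneg r q) fun N =>
    (Finset.sum_le_sum fun j _ => mixedSlice_le_one hr q j).trans (hk.sum_mixedSlice_le q N)

theorem Admissible.hasSum_mixedTerm (hk : Admissible k) {r : ℕ} (hr : 1 ≤ r)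
    (q : Set.Ioo (0 : ℝ) 1) : HasSum (mixedTerm k r q) (∑' j, mixedSlice k r q j) :=
  hasSum_weighted (g := fun m => 1 / (m : ℝ) ^ r) (n := 0) (fun m _ => by positivity)
    (fun j => (hk.summable_tail_and_le _ q).1) (hk.summable_mixedSlice hr q)

theorem Admissible.qzetaMixed_eq (hk : Admissible k) {r : ℕ} (hr : 1 ≤ r)
    (q : Set.Ioo (0 : ℝ) 1) : qzetaMixed k r q = ∑' j, mixedSlice k r q j :=
  (hk.hasSum_mixedTerm hr q).tsum_eq

theorem qzetaMixed_nonneg (r : ℕ) (q : Set.Ioo (0 : ℝ) 1) : 0 ≤ qzetaMixed k r q :=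
  tsum_nonneg fun m => mul_nonneg (Finset.prod_nonneg fun i _ =>
    (qFactor_pos q.2.1 q.2.2 _ (Nat.zero_lt_of_lt (m.2.2 _))).le) (by positivity)

theorem Admissible.qzetaMixed_le (hk : Admissible k) {r : ℕ} (hr : 1 ≤ r)
    (q : Set.Ioo (0 : ℝ) 1) : qzetaMixed k r q ≤ 2 * q ^ (∑ i, k i) := by
  rw [hk.qzetaMixed_eq hr]
  exact Real.tsum_le_of_sum_range_le (mixedSlice_nonneg r q) fun N =>
    (Finset.sum_le_sum fun j _ => mixedSlice_le_one hr q j).trans (hk.sum_mixedSlice_le q N)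

/-- The slice m_{d+1} = 1 has weight 1 whatever r is; this makes the limit in r visible. -/
theorem Admissible.qzetaMixed_eq_add (hk : Admissible k) {r : ℕ} (hr : 1 ≤ r)
    (q : Set.Ioo (0 : ℝ) 1) :
    qzetaMixed k r q = qzetaTail k 1 q + ∑' j, mixedSlice k r q (j + 1) := by
  rw [hk.qzetaMixed_eq hr, (hk.summable_mixedSlice hr q).tsum_eq_zero_add]
  simp [mixedSlice]

theorem Admissible.qzetaTail_lt_qzetaMixed (hk : Admissible k) {r : ℕ} (hr : 1 ≤ r)
    (q : Set.Ioo (0 : ℝ) 1) : qzetaTail k 1 q < qzetaMixed k r q := by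
  rw [hk.qzetaMixed_eq_add hr, lt_add_iff_pos_right]
  refine ((summable_nat_add_iff 1).2 (hk.summable_mixedSlice hr q)).tsum_pos
    (fun j => mixedSlice_nonneg r q _) 0 ?_
  exact mul_pos (by positivity) (qzetaTail_pos (hk.summable_tail_and_le _ q).1)

theorem Admissible.qzetaMixed_sub_le (hk : Admissible k) (r : ℕ) (q : Set.Ioo (0 : ℝ) 1) :
    qzetaMixed k (r + 1) q - qzetaTail k 1 q ≤ (1 / 2) ^ r * 2 := by
  have hs : ∀ {r : ℕ}, 1 ≤ r → Summable fun j => mixedSlice k r q (j + 1) := fun hr =>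
    (summable_nat_add_iff 1).2 (hk.summable_mixedSlice hr q)
  rw [hk.qzetaMixed_eq_add (by omega), add_sub_cancel_left]
  calc ∑' j, mixedSlice k (r + 1) q (j + 1)
      ≤ ∑' j, (1 / 2) ^ r * mixedSlice k 1 q (j + 1) :=
        (hs (by omega)).tsum_le_tsum (fun j => mixedSlice_succ_le r q j)
          ((hs le_rfl).mul_left _)
    _ = (1 / 2) ^ r * ∑' j, mixedSlice k 1 q (j + 1) := tsum_mul_left
    _ ≤ (1 / 2) ^ r * 2 := by
        have h1 := hk.qzetaMixed_eq_add le_rfl q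
        have h2 := hk.qzetaMixed_le le_rfl q
        have h3 := qzetaTail_nonneg k q 1
        have h4 : (q : ℝ) ^ (∑ i, k i) ≤ 1 := pow_le_one₀ q.2.1.le q.2.2.le
        gcongr
        linarith

theorem memℓp_infty_of_nonneg_of_le {f : Set.Ioo (0 : ℝ) 1 → ℝ} {C : ℝ} (h0 : ∀ q, 0 ≤ f q)
    (hC : ∀ q, f q ≤ C) : Memℓp f ∞ := by
  refine memℓp_infty ⟨C, ?_⟩
  rintro _ ⟨q, rfl⟩
  simpa [abs_of_nonneg (h0 q)] using hC q

theorem Admissible.memℓp_qzetaMixed (hk : Admissible k) {r : ℕ} (hr : 1 ≤ r) :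
    Memℓp (qzetaMixed k r) ∞ :=
  memℓp_infty_of_nonneg_of_le (C := 2) (qzetaMixed_nonneg r) fun q => by
    have h1 := hk.qzetaMixed_le hr q
    have h2 : (q : ℝ) ^ (∑ i, k i) ≤ 1 := pow_le_one₀ q.2.1.le q.2.2.le
    linarith

theorem Admissible.memℓp_qzetaTail (hk : Admissible k) : Memℓp (qzetaTail k 1) ∞ :=
  memℓp_infty_of_nonneg_of_le (C := 2) (fun q => qzetaTail_nonneg k q 1) fun q => by
    have h1 := hk.qzetaTail_le q
    have h2 : (q : ℝ) ^ (∑ i, k i) ≤ 1 := pow_le_one₀ q.2.1.le q.2.2.le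
    linarith

theorem admissible_singleton (l : ℕ) : Admissible (fun _ : Fin 1 => l + 2) :=
  ⟨fun _ => Nat.le_add_left 1 (l + 1), Nat.one_pos, Nat.le_add_left 2 l⟩

/-- The bound 2 q^w is not uniform as q → 1; comparison with exponent 2, valid since m ≥ 2, is. -/
theorem qzetaTail_singleton_le (l : ℕ) (q : Set.Ioo (0 : ℝ) 1) :
    qzetaTail (fun _ : Fin 1 => l + 2) 1 q ≤ (1 / 2) ^ l * 2 := by
  have h2 := (admissible_singleton 0).summable_tail_and_le 1 q
  have hle := (admissible_singleton 0).qzetaTail_le q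
  have hq : (q : ℝ) ^ (∑ _i : Fin 1, (0 + 2)) ≤ 1 := pow_le_one₀ q.2.1.le q.2.2.le
  calc qzetaTail (fun _ : Fin 1 => l + 2) 1 q
      ≤ ∑' m, (1 / 2) ^ l * tailTerm (fun _ : Fin 1 => 0 + 2) 1 q m :=
        ((admissible_singleton l).summable_tail_and_le 1 q).1.tsum_le_tsum
          (fun m => by simpa [tailTerm] using qFactor_add_le q.2.1 q.2.2 l (m.2.2 0))
          (h2.1.mul_left _)
    _ = (1 / 2) ^ l * qzetaTail (fun _ : Fin 1 => 0 + 2) 1 q := tsum_mul_left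
    _ ≤ (1 / 2) ^ l * 2 := by
        gcongr
        linarith

end Mixed

/-! ### Accumulation points -/

section Topology

open Filter Topology

theorem exists_accPt_of_accPt_biUnion {X ι : Type*} [TopologicalSpace X] {s : Set ι}
    (hs : s.Finite) {A : ι → Set X} {x : X} (h : AccPt x (𝓟 (⋃ i ∈ s, A i))) :
    ∃ i ∈ s, AccPt x (𝓟 (A i)) := by
  by_contra! hcon
  simp only [accPt_iff_frequently, not_frequently] at hcon
  rw [accPt_iff_frequently] at h
  refine h ?_
  filter_upwards [(eventually_all_finite hs).2 hcon] with y hy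
  rintro ⟨hne, hmem⟩
  simp only [Set.mem_iUnion] at hmem
  obtain ⟨i, hi, hyi⟩ := hmem
  exact hy i hi ⟨hne, hyi⟩

/-- Away from y only finitely many terms remain, and these cannot accumulate in a Hausdorff space.
-/
theorem eq_of_accPt_range {X : Type*} [TopologicalSpace X] [T2Space X] {u : ℕ → X} {x y : X}
    (hu : Tendsto u atTop (𝓝 y)) (h : AccPt x (𝓟 (Set.range u))) : x = y := by
  by_contra hne
  obtain ⟨U, V, hU, hV, hxU, hyV, hdis⟩ := t2_separation hne
  obtain ⟨N, hN⟩ := eventually_atTop.1 (hu.eventually (hV.mem_nhds hyV))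
  refine Set.Infinite.of_accPt (h.nhds_inter (hU.mem_nhds hxU))
    (((Set.finite_Iio N).image u).subset ?_)
  rintro _ ⟨hz, n, rfl⟩
  refine ⟨n, ?_, rfl⟩
  by_contra hn
  exact Set.disjoint_left.1 hdis hz (hN n (not_lt.1 hn))

theorem accPt_of_tendsto {X : Type*} [TopologicalSpace X] {A : Set X} {u : ℕ → X} {x : X}
    (hu : Tendsto u atTop (𝓝 x)) (hA : ∀ n, u n ∈ A) (hne : ∀ n, u n ≠ x) : AccPt x (𝓟 A) :=
  accPt_iff_frequently.2
    (hu.frequently (Eventually.of_forall fun n => ⟨hne n, hA n⟩).frequently)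

theorem tendsto_of_norm_sub_le {u : ℕ → B01} {f : B01}
    (h : ∀ n q, |u n q - f q| ≤ (1 / 2) ^ n * 2) : Tendsto u atTop (𝓝 f) := by
  rw [tendsto_iff_norm_sub_tendsto_zero]
  have hlim : Tendsto (fun n : ℕ => (1 / 2 : ℝ) ^ n * 2) atTop (𝓝 0) := by
    simpa using (tendsto_pow_atTop_nhds_zero_of_lt_one (r := (1 / 2 : ℝ)) (by norm_num)
      (by norm_num)).mul_const 2
  refine squeeze_zero (fun n => norm_nonneg _) (fun n => ?_) hlim
  exact lp.norm_le_of_forall_le (by positivity) fun q => h n q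

/-- The inequality bounds the weight, which bounds both the depth and every entry. -/
theorem finite_admissible_lt {x ε : ℝ} (hx0 : 0 < x) (hx1 : x < 1) (hε : 0 < ε) :
    {p : Σ d, Fin d → ℕ | Admissible p.2 ∧ ε < 2 * x ^ (∑ i, p.2 i)}.Finite := by
  obtain ⟨N, hN⟩ := exists_pow_lt_of_lt_one (half_pos hε) hx1
  refine Set.Finite.subset (s := ⋃ d ∈ Set.Iio N,
    Sigma.mk d '' Set.pi Set.univ (fun _ : Fin d => Set.Iio N)) ?_ ?_
  · exact (Set.finite_Iio N).biUnion fun d _ =>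
      (Set.Finite.pi fun _ => Set.finite_Iio N).image _
  · rintro ⟨d, k⟩ ⟨hk, hlt⟩
    have hw : ∑ i, k i < N := by
      by_contra hcon
      have := pow_le_pow_of_le_one hx0.le hx1.le (not_lt.1 hcon)
      simp only at hlt
      linarith
    have hd : d ≤ ∑ i, k i := by
      simpa using Finset.sum_le_sum fun i (_ : i ∈ Finset.univ) => hk.1 i
    simp only [Set.mem_iUnion]
    refine ⟨d, hd.trans_lt hw, k, fun i _ => ?_, rfl⟩
    exact (Finset.single_le_sum (fun _ _ => Nat.zero_le _) (Finset.mem_univ i)).trans_lt hw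

theorem exists_apply_ne_zero {f : B01} (hf : f ≠ 0) : ∃ q, f q ≠ 0 := by
  by_contra! h
  exact hf (lp.ext (funext h))

theorem setOf_lt_abs_apply_mem_nhds {f : B01} {q : Set.Ioo (0 : ℝ) 1} (hf : f q ≠ 0) :
    {g : B01 | |f q| / 2 < |g q|} ∈ 𝓝 f := by
  have hc : Continuous fun g : B01 => |g q| :=
    (lp.lipschitzWith_one_eval (E := fun _ : Set.Ioo (0 : ℝ) 1 => ℝ) ∞ q).continuous.abs
  exact hc.continuousAt.eventually (lt_mem_nhds (half_lt_self (abs_pos.2 hf)))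

theorem qzTails_subset_derivedSet : QZTails ⊆ derivedSet QZZ := by
  rintro f ⟨d, k, hk, hf⟩
  have hmem := fun r : ℕ => hk.memℓp_qzetaMixed (Nat.succ_pos r)
  refine accPt_of_tendsto (u := fun r => ⟨qzetaMixed k (r + 1), hmem r⟩)
    (tendsto_of_norm_sub_le fun r q => ?_) (fun r => ⟨d, k, r + 1, hk, by omega, rfl⟩)
    fun r h => ?_
  · rw [hf]
    show |qzetaMixed k (r + 1) q - _| ≤ _
    rw [abs_of_pos (sub_pos.2 (hk.qzetaTail_lt_qzetaMixed (by omega) q))]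
    exact hk.qzetaMixed_sub_le r q
  · have h' : qzetaMixed k (r + 1) = qzetaTail k 1 := by
      rw [← hf, ← h]
    exact (hk.qzetaTail_lt_qzetaMixed (by omega) ⟨1 / 2, by norm_num, by norm_num⟩).ne'
      (congrFun h' _)

theorem zero_mem_derivedSet_qzTails : 0 ∈ derivedSet QZTails := by
  have hmem := fun l => (admissible_singleton l).memℓp_qzetaTail
  refine accPt_of_tendsto (u := fun l => ⟨qzetaTail (fun _ : Fin 1 => l + 2) 1, hmem l⟩)
    (tendsto_of_norm_sub_le fun l q => ?_) (fun l => ⟨1, _, admissible_singleton l, rfl⟩)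
    fun l h => ?_
  · show |qzetaTail (fun _ : Fin 1 => l + 2) 1 q - 0| ≤ _
    rw [sub_zero, abs_of_nonneg (qzetaTail_nonneg _ _ _)]
    exact qzetaTail_singleton_le l q
  · have h' : qzetaTail (fun _ : Fin 1 => l + 2) 1 = 0 := congrArg Subtype.val h
    exact (qzetaTail_pos ((admissible_singleton l).summable_tail_and_le 1
      ⟨1 / 2, by norm_num, by norm_num⟩).1).ne' (congrFun h' _)

theorem zero_mem_derivedSet_qzz : 0 ∈ derivedSet QZZ :=
  (isClosed_iff_derivedSet_subset _).1 (isClosed_derivedSet QZZ)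
    (derivedSet_mono _ _ qzTails_subset_derivedSet zero_mem_derivedSet_qzTails)

theorem mem_qzTails_of_mem_derivedSet {f : B01} (hf : f ∈ derivedSet QZZ) (h0 : f ≠ 0) :
    f ∈ QZTails := by
  obtain ⟨q, hq⟩ := exists_apply_ne_zero h0
  have hacc := AccPt.nhds_inter hf (setOf_lt_abs_apply_mem_nhds hq)
  set S := {p : Σ d, Fin d → ℕ | Admissible p.2 ∧ |f q| / 2 < 2 * (q : ℝ) ^ (∑ i, p.2 i)}
  have hS : S.Finite := finite_admissible_lt q.2.1 q.2.2 (half_pos (abs_pos.2 hq))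
  -- Near f the set is covered by finitely many sequences in r, one for each index in `S`; one of
  -- them accumulates at f.
  obtain ⟨⟨d, k⟩, ⟨hk, -⟩, hp⟩ := exists_accPt_of_accPt_biUnion hS (x := f)
    (A := fun p => {g : B01 | ∃ r, (g : Set.Ioo (0 : ℝ) 1 → ℝ) = qzetaMixed p.2 (r + 1)}) <| by
      refine hacc.mono (principal_mono.2 ?_)
      rintro g ⟨hg, d, k, r, hk, hr, e⟩
      simp only [Set.mem_iUnion]
      refine ⟨⟨d, k⟩, ⟨hk, ?_⟩, r - 1, by rw [e, Nat.sub_add_cancel hr]⟩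
      have hg' : |f q| / 2 < |g q| := hg
      rw [e, abs_of_nonneg (qzetaMixed_nonneg r q)] at hg'
      exact hg'.trans_le (hk.qzetaMixed_le hr q)
  have hmem := fun r : ℕ => hk.memℓp_qzetaMixed (Nat.succ_pos r)
  have ht : Tendsto (fun r => (⟨qzetaMixed k (r + 1), hmem r⟩ : B01)) atTop
      (𝓝 ⟨qzetaTail k 1, hk.memℓp_qzetaTail⟩) := tendsto_of_norm_sub_le fun r q => by
    show |qzetaMixed k (r + 1) q - qzetaTail k 1 q| ≤ _
    rw [abs_of_pos (sub_pos.2 (hk.qzetaTail_lt_qzetaMixed (by omega) q))]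
    exact hk.qzetaMixed_sub_le r q
  have he := eq_of_accPt_range ht <| AccPt.mono hp <| principal_mono.2 <| by
    rintro g ⟨r, e⟩
    exact ⟨r, lp.ext e.symm⟩
  exact ⟨d, k, hk, congrArg Subtype.val he⟩

theorem derivedSet_qzz : derivedSet QZZ = QZTails ∪ {0} := by
  refine Set.Subset.antisymm (fun f hf => ?_)
    (Set.union_subset qzTails_subset_derivedSet
      (Set.singleton_subset_iff.2 zero_mem_derivedSet_qzz))
  by_cases h0 : f = 0
  · exact Or.inr h0
  · exact Or.inl (mem_qzTails_of_mem_derivedSet hf h0)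

theorem derivedSet_qzTails_union : derivedSet (QZTails ∪ {0}) = {0} := by
  refine Set.Subset.antisymm (fun f hf => ?_) (Set.singleton_subset_iff.2
    (derivedSet_mono _ _ Set.subset_union_left zero_mem_derivedSet_qzTails))
  by_contra h0
  obtain ⟨q, hq⟩ := exists_apply_ne_zero (f := f) h0
  have hacc := AccPt.nhds_inter hf (setOf_lt_abs_apply_mem_nhds hq)
  have hS := finite_admissible_lt q.2.1 q.2.2 (half_pos (abs_pos.2 hq))
  -- Near f only finitely many tails survive, and 0 is excluded, its value at q being too small.
  refine Set.Infinite.of_accPt hacc (Set.Finite.of_finite_image (f := fun g : B01 => g.1)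
    ((hS.image fun p => qzetaTail p.2 1).subset ?_) Subtype.val_injective.injOn)
  rintro _ ⟨g, ⟨hg, hg'⟩, rfl⟩
  have hg1 : |f q| / 2 < |g q| := hg
  rcases hg' with ⟨d, k, hk, e⟩ | rfl
  · refine ⟨⟨d, k⟩, ⟨hk, ?_⟩, e.symm⟩
    rw [e, abs_of_nonneg (qzetaTail_nonneg k q 1)] at hg1
    exact hg1.trans_le (hk.qzetaTail_le q)
  · have : (0 : B01) q = 0 := rfl
    rw [this, abs_zero] at hg1
    linarith [abs_nonneg (f q)]

end Topology

/-- The first two conjuncts say that the functions in question are given by convergent series and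
belong to `B(0,1)`; the last two are the computation of the derived sets. -/
theorem theorem3 :
    (∀ (d : ℕ) (k : Fin d → ℕ) (r : ℕ), Admissible k → 1 ≤ r →
      (∀ q : Set.Ioo (0 : ℝ) 1, Summable (mixedTerm k r q)) ∧ Memℓp (qzetaMixed k r) ∞) ∧
    (∀ (d : ℕ) (k : Fin d → ℕ), Admissible k →
      (∀ q : Set.Ioo (0 : ℝ) 1, Summable (tailTerm k 1 q)) ∧ Memℓp (qzetaTail k 1) ∞) ∧
    derivedSet QZZ = QZTails ∪ {0} ∧
    derivedSet (derivedSet QZZ) = {0} := by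
  refine ⟨fun d k r hk hr => ⟨fun q => (hk.hasSum_mixedTerm hr q).summable,
      hk.memℓp_qzetaMixed hr⟩,
    fun d k hk => ⟨fun q => (hk.summable_tail_and_le 1 q).1, hk.memℓp_qzetaTail⟩,
    derivedSet_qzz, ?_⟩
  rw [derivedSet_qzz, derivedSet_qzTails_union]
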